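/- Let $n\ge k\ge 2$ be integers and let $P\subset\mathbb{R}^d$ be a $(k-1)$-dimensional polytope (the convex hull of a finite set). Let $F(P)$ be the set of non-empty proper faces of $P$, and for $v\in P$ let $\mathrm{supp}(v)$ be the minimal face of $P$ containing $v$. For every $\tau\in F(P)$ let points $y^1_\tau,\dots,y^n_\tau\in\tau$ and closed sets $A^1_\tau,\dots,A^n_\tau\subseteq P$ be given, and assume that $(A^i_\tau)$ is a $k$-weakly Komiya cover of $P$: for every $I\subseteq[n]$ with $|I|=n-k+1$ and every face $\sigma$ of $P$ (including $\sigma=P$), $$\sigma\subseteq\bigcup_{\tau\in F(P),\ \tau\subseteq\sigma}\ \bigcup_{i\in I}A^i_\tau .$$ Let $T$ be a (finite, convex) triangulation of $P$, i.e. a finite geometric simplicial complex with underlying space $P$. Then there exist a triangulation $T'$ of $P$ refining $T$ and maps $\lambda:V(T')\to F(P)$, $f:V(T')\to[n]$ and $y:V(T')\to P$ such that (P1) $v\in A^{f(v)}_{\lambda(v)}$ for every $v\in V(T')$; (P2) $y(v)\in\lambda(v)\subseteq\mathrm{supp}(v)$ for every $v\in V(T')$, and moreover $y(v)=y^{f(v)}_{\lambda(v)}$;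 (P3) for every face $\tau$ of $T'$, the indices $f(v)$, $v\in V(\tau)$, are pairwise distinct. Moreover, $T'$ can be chosen to be obtained from $T$ by finitely many successive edge subdivisions. Here subdividing an edge $v_1v_2$ of a triangulation $X$ at its midpoint $b$ means replacing every face $\mathrm{conv}\{v_1,v_2,v_3,\dots,v_j\}$ of $X$ that contains this edge by the two faces $\mathrm{conv}\{b,v_2,v_3,\dots,v_j\}$ and $\mathrm{conv}\{b,v_1,v_3,\dots,v_j\}$, together with those of their faces that contain $b$. -/

import Mathlib

open Geometry

/-- `P` is a convex polytope: the convex hull of a finite set of points. -/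
def IsPolytope {E : Type*} [AddCommGroup E] [Module ℝ E] (P : Set E) : Prop :=
  ∃ V : Finset E, P = convexHull ℝ (V : Set E)

/-- `F` is a (possibly empty, possibly improper) face of the convex set `P`: a convex subset of `P`
which contains both end points of every segment in `P` whose relative interior it meets.
For a polytope these are the same sets as those cut out by supporting hyperplanes, together with
`∅` and `P`. -/
def IsFace {E : Type*} [AddCommGroup E] [Module ℝ E] (P F : Set E) : Prop :=
  IsExtreme ℝ P F ∧ Convex ℝ F

/-- `F(P)`: the set of non-empty proper faces of `P`. -/
def ProperFaces {E : Type*} [AddCommGroup E] [Module ℝ E] (P : Set E) : Set (Set E) :=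
  {F | IsFace P F ∧ F.Nonempty ∧ F ≠ P}

/-- `supp(v)`: the minimal face of `P` containing `v`, as the intersection of all faces of `P`
containing `v` (`P` itself is one of them if `P` is convex and `v ∈ P`). -/
def facialSupport {E : Type*} [AddCommGroup E] [Module ℝ E] (P : Set E) (v : E) : Set E :=
  ⋂₀ {F | IsFace P F ∧ v ∈ F}

/-- A family `A` of subsets of `P` indexed by `F(P)` is a Komiya cover of `P`: all sets are closed,
and every face `σ` of `P` (including `P` itself) is covered by the sets `A τ`, `τ ∈ F(P)`, `τ ⊆ σ`.
-/
structure IsKomiyaCover {E : Type*} [AddCommGroup E] [Module ℝ E] [TopologicalSpace E]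
    (P : Set E) (A : ProperFaces P → Set E) : Prop where
  isClosed : ∀ τ, IsClosed (A τ)
  subset : ∀ τ, A τ ⊆ P
  covers : ∀ σ : Set E, IsFace P σ →
    σ ⊆ ⋃ τ : {τ : ProperFaces P // (τ : Set E) ⊆ σ}, A τ.1

/-- An `m`-weakly Komiya cover of `P`: a family of closed subsets `A i τ` of `P`
(`i ∈ [n]`, `τ ∈ F(P)`) such that for each `I ⊆ [n]` with `n - m + 1` elements, the unions
`⋃ i ∈ I, A i τ` form a Komiya cover of `P`. -/
structure IsWeaklyKomiyaCover {E : Type*} [AddCommGroup E] [Module ℝ E] [TopologicalSpace E]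
    {n : ℕ} (m : ℕ) (P : Set E) (A : Fin n → ProperFaces P → Set E) : Prop where
  isClosed : ∀ i τ, IsClosed (A i τ)
  subset : ∀ i τ, A i τ ⊆ P
  weaklyCovers : ∀ I : Finset (Fin n), I.card + m = n + 1 →
    IsKomiyaCover P (fun τ => ⋃ i ∈ I, A i τ)

/-- A (convex) triangulation of `P`: a finite geometric simplicial complex whose simplices, the
convex hulls of their vertex sets, have union `P`. -/
def IsTriangulation {E : Type*} [AddCommGroup E] [Module ℝ E]
    (T : SimplicialComplex ℝ E) (P : Set E) : Prop :=
  T.faces.Finite ∧ T.space = P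

/-- `T'` refines `T`: both have the same underlying space, and each simplex of `T'` lies in a
simplex of `T`. -/
def Refines {E : Type*} [AddCommGroup E] [Module ℝ E] (T' T : SimplicialComplex ℝ E) : Prop :=
  T'.space = T.space ∧
    ∀ s ∈ T'.faces, ∃ t ∈ T.faces, convexHull ℝ (s : Set E) ⊆ convexHull ℝ (t : Set E)

open Classical in
/-- `Y` is obtained from `X` by subdividing the edge `uv` at its barycenter `b`: the simplices of `X`
containing both `u` and `v` are removed, and the simplices `conv ({b} ∪ t)` are added for those `t`
(possibly empty) which do not contain both `u` and `v` but for which `t ∪ {u, v}` spans a simplex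
of `X`. -/
def IsEdgeSubdivision {E : Type*} [AddCommGroup E] [Module ℝ E]
    (X : SimplicialComplex ℝ E) (u v : E) (Y : SimplicialComplex ℝ E) : Prop :=
  u ≠ v ∧ {u, v} ∈ X.faces ∧
    Y.faces = {s | s ∈ X.faces ∧ ¬ {u, v} ⊆ s} ∪
      {s | ∃ t : Finset E, t ∪ {u, v} ∈ X.faces ∧ ¬ {u, v} ⊆ t ∧ s = insert (midpoint ℝ u v) t}

/-- `T'` is obtained from `T` by finitely many successive edge subdivisions. -/
def IsIteratedEdgeSubdivision {E : Type*} [AddCommGroup E] [Module ℝ E]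
    (T T' : SimplicialComplex ℝ E) : Prop :=
  Relation.ReflTransGen (fun X Y => ∃ u v, IsEdgeSubdivision X u v Y) T T'

/-! This is a list-colouring argument. Give each point `v` of `P` the list of colours `i` for which
some `τ ⊆ supp(v)` has `v ∈ A i τ`. Applying the cover condition to the face `supp(v)` shows that
every list has at least `k` colours (`IsWeaklyKomiyaCover.exists_notMem`), while a simplex in `P`
has at most `k` vertices. It remains to subdivide until a colouring from the lists is injective on
every facet.

If a facet has two vertices `u`, `v` of the same colour, its colour set `S` has fewer than `k`
elements. Subdivide `uv` and colour the midpoint by some `c ∉ S` from its list. Each facet through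
`uv` is replaced by two, each losing only one of `u`, `v`, so its colour set only gains `c`. Hence
the number of conflicting facets with colour set exactly `S` drops, and all other new colour sets
contain old ones. Treating minimal colour sets first, the process ends.

That an edge subdivision is again a simplicial complex is checked through uniqueness of convex
weights. -/

/-! ### Simplicial complexes via uniqueness of convex weights -/

section ConvexCombination

variable {E : Type*} [AddCommGroup E] [Module ℝ E]

/-- `w` is a finitely supported system of convex weights on points of `E` with barycenter `x`. -/
def IsConvexCombination (w : E →₀ ℝ) (x : E) : Prop :=
  (∀ a, 0 ≤ w a) ∧ Finsupp.linearCombination ℝ (fun _ : E => (1 : ℝ)) w = 1 ∧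
    Finsupp.linearCombination ℝ (id : E → E) w = x

theorem mem_convexHull_iff_exists_isConvexCombination {s : Finset E} {x : E} :
    x ∈ convexHull ℝ (s : Set E) ↔ ∃ w : E →₀ ℝ, IsConvexCombination w x ∧ w.support ⊆ s := by
  classical
  rw [Finset.mem_convexHull']
  constructor
  · rintro ⟨w, h0, h1, hx⟩
    refine ⟨Finsupp.onFinset s (fun a => if a ∈ s then w a else 0)
      (fun a ha => by by_contra h; simp [h] at ha), ⟨?_, ?_, ?_⟩,
      Finsupp.support_onFinset_subset⟩
    · intro a
      by_cases ha : a ∈ s <;> simp [ha, h0]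
    · rw [Finsupp.linearCombination_onFinset]
      refine Eq.trans ?_ h1
      exact Finset.sum_congr rfl fun a ha => by simp [ha]
    · rw [Finsupp.linearCombination_onFinset, ← hx]
      exact Finset.sum_congr rfl fun a ha => by simp [ha]
  · rintro ⟨w, ⟨h0, h1, hx⟩, hs⟩
    refine ⟨w, fun a _ => h0 a, ?_, ?_⟩
    · rw [← h1, Finsupp.linearCombination_apply, Finsupp.sum_of_support_subset _ hs _ (by simp)]
      simp
    · rw [← hx, Finsupp.linearCombination_apply, Finsupp.sum_of_support_subset _ hs _ (by simp)]
      simp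

theorem AffineIndependent.eq_of_isConvexCombination {s : Finset E}
    (hs : AffineIndependent ℝ ((↑) : s → E)) {w₁ w₂ : E →₀ ℝ} {x : E}
    (h₁ : IsConvexCombination w₁ x) (h₂ : IsConvexCombination w₂ x)
    (hs₁ : w₁.support ⊆ s) (hs₂ : w₂.support ⊆ s) : w₁ = w₂ := by
  classical
  have hsub : (w₁ - w₂).support ⊆ s :=
    Finsupp.support_sub.trans (Finset.union_subset hs₁ hs₂)
  have e1 : Finsupp.linearCombination ℝ (fun _ : E => (1 : ℝ)) (w₁ - w₂) = 0 := by
    rw [map_sub, h₁.2.1, h₂.2.1, sub_self]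
  have e2 : Finsupp.linearCombination ℝ (id : E → E) (w₁ - w₂) = 0 := by
    rw [map_sub, h₁.2.2, h₂.2.2, sub_self]
  rw [Finsupp.linearCombination_apply, Finsupp.sum_of_support_subset _ hsub _ (by simp)] at e1 e2
  have key := hs.eq_zero_of_sum_eq_zero_subtype (w := w₁ - w₂) (by simpa using e1)
    (by simpa using e2)
  ext a
  by_cases ha : a ∈ s
  · simpa [sub_eq_zero] using key a ha
  · rw [Finsupp.notMem_support_iff.1 fun h => ha (hs₁ h),
      Finsupp.notMem_support_iff.1 fun h => ha (hs₂ h)]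

/-- The point lies in the hull of `s ∩ t`; weights there agree with both given systems by affine
independence of `s` and of `t`. -/
theorem Geometry.SimplicialComplex.eq_of_isConvexCombination (X : SimplicialComplex ℝ E)
    {s t : Finset E} (hs : s ∈ X.faces) (ht : t ∈ X.faces) {w₁ w₂ : E →₀ ℝ} {x : E}
    (h₁ : IsConvexCombination w₁ x) (h₂ : IsConvexCombination w₂ x)
    (hs₁ : w₁.support ⊆ s) (ht₂ : w₂.support ⊆ t) : w₁ = w₂ := by
  classical
  have hx : x ∈ convexHull ℝ ((s ∩ t : Finset E) : Set E) := by
    rw [Finset.coe_inter]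
    exact X.inter_subset_convexHull hs ht
      ⟨mem_convexHull_iff_exists_isConvexCombination.2 ⟨_, h₁, hs₁⟩,
        mem_convexHull_iff_exists_isConvexCombination.2 ⟨_, h₂, ht₂⟩⟩
  obtain ⟨w, hw, hws⟩ := mem_convexHull_iff_exists_isConvexCombination.1 hx
  rw [(X.indep hs).eq_of_isConvexCombination h₁ hw hs₁ (hws.trans Finset.inter_subset_left),
    (X.indep ht).eq_of_isConvexCombination h₂ hw ht₂ (hws.trans Finset.inter_subset_right)]

/-- By Radon, a dependent set has two disjoint parts whose hulls meet; equal weights would then have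
empty support but total 1. -/
theorem affineIndependent_of_isConvexCombination_unique {s : Finset E}
    (h : ∀ (w₁ w₂ : E →₀ ℝ) (x : E), IsConvexCombination w₁ x → IsConvexCombination w₂ x →
      w₁.support ⊆ s → w₂.support ⊆ s → w₁ = w₂) :
    AffineIndependent ℝ ((↑) : s → E) := by
  classical
  by_contra hs
  obtain ⟨I, x, hx₁, hx₂⟩ := Convex.radon_partition hs
  have himage : ∀ J : Set s, ∃ t : Finset E, (t : Set E) = ((↑) : s → E) '' J ∧ t ⊆ s := by
    intro J
    refine ⟨J.toFinite.toFinset.image (↑), by simp, ?_⟩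
    intro a ha
    simp only [Finset.mem_image] at ha
    obtain ⟨b, -, rfl⟩ := ha
    exact b.2
  obtain ⟨t₁, e₁, hts₁⟩ := himage I
  obtain ⟨t₂, e₂, hts₂⟩ := himage Iᶜ
  rw [← e₁] at hx₁
  rw [← e₂] at hx₂
  obtain ⟨w₁, hw₁, hs₁⟩ := mem_convexHull_iff_exists_isConvexCombination.1 hx₁
  obtain ⟨w₂, hw₂, hs₂⟩ := mem_convexHull_iff_exists_isConvexCombination.1 hx₂
  obtain rfl := h _ _ _ hw₁ hw₂ (hs₁.trans hts₁) (hs₂.trans hts₂)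
  have hdisj : Disjoint t₁ t₂ := by
    rw [← Finset.disjoint_coe, e₁, e₂]
    exact Set.disjoint_image_of_injective Subtype.val_injective disjoint_compl_right
  have hempty : w₁.support = ∅ := by
    rw [← Finset.subset_empty, ← Finset.disjoint_iff_inter_eq_empty.1 hdisj]
    exact Finset.subset_inter hs₁ hs₂
  have h1 := hw₁.2.1
  rw [Finsupp.support_eq_empty.1 hempty, map_zero] at h1
  exact zero_ne_one h1

/-- A down-closed family of non-empty finite sets with unique convex weights is a simplicial
complex. -/
def Geometry.SimplicialComplex.ofUniqueWeights (faces : Set (Finset E))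
    (lower : IsRelLowerSet faces Finset.Nonempty)
    (unique : ∀ s ∈ faces, ∀ t ∈ faces, ∀ (w₁ w₂ : E →₀ ℝ) (x : E), IsConvexCombination w₁ x →
      IsConvexCombination w₂ x → w₁.support ⊆ s → w₂.support ⊆ t → w₁ = w₂) :
    SimplicialComplex ℝ E where
  faces := faces
  isRelLowerSet_faces := lower
  indep hs := affineIndependent_of_isConvexCombination_unique (unique _ hs _ hs)
  inter_subset_convexHull {s t} hs ht := by
    classical
    rintro x ⟨hx₁, hx₂⟩
    obtain ⟨w₁, hw₁, hs₁⟩ := mem_convexHull_iff_exists_isConvexCombination.1 hx₁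
    obtain ⟨w₂, hw₂, hs₂⟩ := mem_convexHull_iff_exists_isConvexCombination.1 hx₂
    obtain rfl := unique _ hs _ ht _ _ _ hw₁ hw₂ hs₁ hs₂
    rw [← Finset.coe_inter]
    exact mem_convexHull_iff_exists_isConvexCombination.2 ⟨_, hw₁, Finset.subset_inter hs₁ hs₂⟩

end ConvexCombination

/-! ### Construction of the edge subdivision -/

section EdgeSubdivision

variable {E : Type*} [AddCommGroup E] [Module ℝ E]

/-- Move the weight of the midpoint of `u` and `v` to `u` and `v`, in equal parts. -/
noncomputable def spreadMidpoint (u v : E) (w : E →₀ ℝ) : E →₀ ℝ :=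
  w - Finsupp.single (midpoint ℝ u v) (w (midpoint ℝ u v)) +
    (Finsupp.single u (w (midpoint ℝ u v) / 2) + Finsupp.single v (w (midpoint ℝ u v) / 2))

variable {u v : E}

theorem midpoint_ne_left_of_ne (h : u ≠ v) : midpoint ℝ u v ≠ u := by
  simpa [midpoint_eq_left_iff] using h

theorem midpoint_ne_right_of_ne (h : u ≠ v) : midpoint ℝ u v ≠ v := by
  simpa [midpoint_eq_right_iff] using h

theorem spreadMidpoint_midpoint (h : u ≠ v) (w : E →₀ ℝ) :
    spreadMidpoint u v w (midpoint ℝ u v) = 0 := by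
  simp [spreadMidpoint, (midpoint_ne_left_of_ne h).symm,
    (midpoint_ne_right_of_ne h).symm]

theorem spreadMidpoint_left (h : u ≠ v) (w : E →₀ ℝ) :
    spreadMidpoint u v w u = w u + w (midpoint ℝ u v) / 2 := by
  simp [spreadMidpoint, midpoint_ne_left_of_ne h, h.symm]

theorem spreadMidpoint_right (h : u ≠ v) (w : E →₀ ℝ) :
    spreadMidpoint u v w v = w v + w (midpoint ℝ u v) / 2 := by
  simp [spreadMidpoint, h]

theorem spreadMidpoint_of_ne {w : E →₀ ℝ} {a : E} (hu : a ≠ u) (hv : a ≠ v)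
    (hb : a ≠ midpoint ℝ u v) : spreadMidpoint u v w a = w a := by
  simp [spreadMidpoint, hu.symm, hv.symm, hb.symm]

theorem IsConvexCombination.spreadMidpoint (h : u ≠ v) {w : E →₀ ℝ} {x : E}
    (hw : IsConvexCombination w x) : IsConvexCombination (spreadMidpoint u v w) x := by
  obtain ⟨h0, h1, hx⟩ := hw
  refine ⟨fun a => ?_, ?_, ?_⟩
  · by_cases hb : a = midpoint ℝ u v
    · rw [hb, spreadMidpoint_midpoint h]
    by_cases hau : a = u
    · rw [hau, spreadMidpoint_left h]
      have := h0 u; have := h0 (midpoint ℝ u v); positivity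
    by_cases hav : a = v
    · rw [hav, spreadMidpoint_right h]
      have := h0 v; have := h0 (midpoint ℝ u v); positivity
    rw [spreadMidpoint_of_ne hau hav hb]
    exact h0 a
  · simp only [_root_.spreadMidpoint, map_add, map_sub, h1, Finsupp.linearCombination_single]
    simp
  · simp only [_root_.spreadMidpoint, map_add, map_sub, hx, Finsupp.linearCombination_single, id]
    rw [midpoint_eq_smul_add, invOf_eq_inv]
    generalize w _ = r
    module

theorem spreadMidpoint_support_subset [DecidableEq E] {w : E →₀ ℝ} {t : Finset E} (h : u ≠ v)
    (hw : w.support ⊆ insert (midpoint ℝ u v) t) :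
    (spreadMidpoint u v w).support ⊆ t ∪ {u, v} := by
  intro a ha
  rw [Finsupp.mem_support_iff] at ha
  by_contra hat
  simp only [Finset.mem_union, Finset.mem_insert, Finset.mem_singleton, not_or] at hat
  by_cases hb : a = midpoint ℝ u v
  · exact ha (hb ▸ spreadMidpoint_midpoint h w)
  rw [spreadMidpoint_of_ne hat.2.1 hat.2.2 hb] at ha
  have := hw (Finsupp.mem_support_iff.2 ha)
  simp [hb, hat.1] at this

/-- Since one of the weights at `u`, `v` vanishes, half the midpoint weight is the smaller of the
spread weights at `u` and `v`, so it can be recovered. -/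
theorem eq_of_spreadMidpoint_eq (h : u ≠ v) {w₁ w₂ : E →₀ ℝ}
    (hw₁ : ∀ a, 0 ≤ w₁ a) (hw₂ : ∀ a, 0 ≤ w₂ a) (huv₁ : w₁ u = 0 ∨ w₁ v = 0)
    (huv₂ : w₂ u = 0 ∨ w₂ v = 0) (heq : spreadMidpoint u v w₁ = spreadMidpoint u v w₂) :
    w₁ = w₂ := by
  have hu := DFunLike.congr_fun heq u
  have hv := DFunLike.congr_fun heq v
  rw [spreadMidpoint_left h, spreadMidpoint_left h] at hu
  rw [spreadMidpoint_right h, spreadMidpoint_right h] at hv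
  have hb : w₁ (midpoint ℝ u v) = w₂ (midpoint ℝ u v) := by
    have := hw₁ u; have := hw₁ v; have := hw₂ u; have := hw₂ v
    rcases huv₁ with h1 | h1 <;> rcases huv₂ with h2 | h2 <;> linarith
  ext a
  by_cases hab : a = midpoint ℝ u v
  · rw [hab, hb]
  by_cases hau : a = u
  · rw [hau]; linarith
  by_cases hav : a = v
  · rw [hav]; linarith
  have := DFunLike.congr_fun heq a
  rwa [spreadMidpoint_of_ne hau hav hab, spreadMidpoint_of_ne hau hav hab] at this

variable (X : SimplicialComplex ℝ E)

/-- Otherwise the midpoint would have two weight systems on faces of `X`: the unit mass, and one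
half at each of `u`, `v`. -/
theorem midpoint_notMem_of_mem_faces (h : u ≠ v) {s : Finset E} (hs : s ∈ X.faces)
    (he : ∃ t ∈ X.faces, u ∈ t ∧ v ∈ t) : midpoint ℝ u v ∉ s := by
  classical
  intro hb
  obtain ⟨t, ht, hu, hv⟩ := he
  have h₁ : IsConvexCombination (Finsupp.single (midpoint ℝ u v) (1 : ℝ)) (midpoint ℝ u v) := by
    refine ⟨fun a => ?_, by simp, by simp⟩
    rw [Finsupp.single_apply]
    split_ifs <;> norm_num
  have key := X.eq_of_isConvexCombination hs ht h₁ (h₁.spreadMidpoint h)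
    (Finsupp.support_single_subset.trans (by simpa using hb))
    ((spreadMidpoint_support_subset h (t := ∅) (by simp)).trans
      (by simp [Finset.insert_subset_iff, hu, hv]))
  have := DFunLike.congr_fun key (midpoint ℝ u v)
  simp [spreadMidpoint_midpoint h] at this

open Classical in
/-- The faces of the subdivision of `X` at the midpoint of `u` and `v`. -/
def edgeSubdivisionFaces (u v : E) : Set (Finset E) :=
  {s | s ∈ X.faces ∧ ¬ {u, v} ⊆ s} ∪
      {s | ∃ t : Finset E, t ∪ {u, v} ∈ X.faces ∧ ¬ {u, v} ⊆ t ∧ s = insert (midpoint ℝ u v) t}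

open Classical in
theorem edgeSubdivisionFaces_lower (u v : E) :
    IsRelLowerSet (edgeSubdivisionFaces X u v) Finset.Nonempty := by
  rintro s (⟨hs, huv⟩ | ⟨t, ht, huv, rfl⟩)
  · exact ⟨X.nonempty_of_mem_faces hs, fun r hrs hr =>
      Or.inl ⟨X.down_closed hs hrs hr, fun h' => huv (h'.trans hrs)⟩⟩
  · refine ⟨Finset.insert_nonempty _ _, fun r hrs hr => ?_⟩
    by_cases hb : midpoint ℝ u v ∈ r
    · have hrt : r.erase (midpoint ℝ u v) ⊆ t := by rwa [← Finset.subset_insert_iff]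
      refine Or.inr ⟨r.erase (midpoint ℝ u v), X.down_closed ht
        (Finset.union_subset_union_left hrt) ⟨u, by simp⟩, fun h' => huv (h'.trans hrt), ?_⟩
      rw [Finset.insert_erase hb]
    · have hrt : r ⊆ t := (Finset.subset_insert_iff_of_notMem hb).1 hrs
      exact Or.inl ⟨X.down_closed ht (hrt.trans Finset.subset_union_left) hr,
        fun h' => huv (h'.trans hrt)⟩

open Classical in
theorem edgeSubdivisionFaces_spread {u v : E} (h : u ≠ v) (he : {u, v} ∈ X.faces) {s : Finset E}
    (hs : s ∈ edgeSubdivisionFaces X u v) {w : E →₀ ℝ} (hw : w.support ⊆ s) :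
    (w u = 0 ∨ w v = 0) ∧ ∃ t ∈ X.faces, (spreadMidpoint u v w).support ⊆ t := by
  have hzero : ∀ r : Finset E, w.support ⊆ insert (midpoint ℝ u v) r → ¬ {u, v} ⊆ r →
      w u = 0 ∨ w v = 0 := by
    intro r hr hn
    by_contra! hne
    refine hn (Finset.insert_subset ?_ (Finset.singleton_subset_iff.2 ?_))
    · exact Finset.mem_of_mem_insert_of_ne (hr (Finsupp.mem_support_iff.2 hne.1))
        (midpoint_ne_left_of_ne h).symm
    · exact Finset.mem_of_mem_insert_of_ne (hr (Finsupp.mem_support_iff.2 hne.2))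
        (midpoint_ne_right_of_ne h).symm
  rcases hs with ⟨hs, huv⟩ | ⟨t, ht, huv, rfl⟩
  · refine ⟨hzero s (hw.trans (Finset.subset_insert _ _)) huv, s, hs, ?_⟩
    have hb : w (midpoint ℝ u v) = 0 := by
      by_contra hb
      exact midpoint_notMem_of_mem_faces X h hs ⟨_, he, by simp, by simp⟩
        (hw (Finsupp.mem_support_iff.2 hb))
    simpa [spreadMidpoint, hb] using hw
  · exact ⟨hzero t hw huv, _, ht, spreadMidpoint_support_subset h hw⟩

/-- The subdivision of a simplicial complex at the midpoint of an edge. -/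
noncomputable def edgeSubdivision {u v : E} (h : u ≠ v)
    (he : ∃ s ∈ X.faces, u ∈ s ∧ v ∈ s) : SimplicialComplex ℝ E :=
  SimplicialComplex.ofUniqueWeights (edgeSubdivisionFaces X u v)
    (edgeSubdivisionFaces_lower X u v) (by
      classical
      intro s hs t ht w₁ w₂ x h₁ h₂ hs₁ ht₂
      obtain ⟨r, hr, hu, hv⟩ := he
      have he : {u, v} ∈ X.faces :=
        X.down_closed hr (by simp [Finset.insert_subset_iff, hu, hv]) (by simp)
      obtain ⟨z₁, s', hs', e₁⟩ := edgeSubdivisionFaces_spread X h (by convert he) hs hs₁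
      obtain ⟨z₂, t', ht', e₂⟩ := edgeSubdivisionFaces_spread X h (by convert he) ht ht₂
      exact eq_of_spreadMidpoint_eq h h₁.1 h₂.1 z₁ z₂
        (X.eq_of_isConvexCombination hs' ht' (h₁.spreadMidpoint h) (h₂.spreadMidpoint h) e₁ e₂))

open Classical in
theorem isEdgeSubdivision_edgeSubdivision {u v : E} (h : u ≠ v)
    (he : ∃ s ∈ X.faces, u ∈ s ∧ v ∈ s) :
    IsEdgeSubdivision X u v (edgeSubdivision X h he) := by
  refine ⟨h, ?_, rfl⟩
  obtain ⟨r, hr, hu, hv⟩ := he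
  exact X.down_closed hr (by simp [Finset.insert_subset_iff, hu, hv]) (by simp)

end EdgeSubdivision

/-! ### Edge subdivisions preserve the space and refine -/

section IsEdgeSubdivision

variable {E : Type*} [AddCommGroup E] [Module ℝ E] {X Y : SimplicialComplex ℝ E} {u v : E}

open Classical in
theorem IsEdgeSubdivision.mem_faces_iff (h : IsEdgeSubdivision X u v Y) {s : Finset E} :
    s ∈ Y.faces ↔ (s ∈ X.faces ∧ ¬ {u, v} ⊆ s) ∨
      ∃ t : Finset E, t ∪ {u, v} ∈ X.faces ∧ ¬ {u, v} ⊆ t ∧ s = insert (midpoint ℝ u v) t := by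
  rw [h.2.2]
  rfl

theorem IsEdgeSubdivision.symm (h : IsEdgeSubdivision X u v Y) : IsEdgeSubdivision X v u Y := by
  classical
  unfold IsEdgeSubdivision at *
  rw [Finset.pair_comm v u, midpoint_comm (R := ℝ) v u]
  exact ⟨h.1.symm, h.2⟩

theorem IsEdgeSubdivision.finite (h : IsEdgeSubdivision X u v Y) (hX : X.faces.Finite) :
    Y.faces.Finite := by
  classical
  refine (hX.union ((hX.biUnion fun s _ => (s.powerset.finite_toSet)).image
    (insert (midpoint ℝ u v)))).subset fun s hs => ?_
  rcases h.mem_faces_iff.1 hs with ⟨hs, -⟩ | ⟨t, ht, -, rfl⟩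
  · exact Or.inl hs
  · refine Or.inr ⟨t, ?_, by congr⟩
    simp only [Set.mem_iUnion]
    exact ⟨_, ht, Finset.mem_coe.2 (Finset.mem_powerset.2 Finset.subset_union_left)⟩

theorem IsEdgeSubdivision.exists_convexHull_subset (h : IsEdgeSubdivision X u v Y) {s : Finset E}
    (hs : s ∈ Y.faces) :
    ∃ t ∈ X.faces, convexHull ℝ (s : Set E) ⊆ convexHull ℝ (t : Set E) := by
  classical
  rcases h.mem_faces_iff.1 hs with ⟨hs, -⟩ | ⟨t, ht, -, rfl⟩
  · exact ⟨s, hs, subset_rfl⟩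
  · refine ⟨_, ht, convexHull_min ?_ (convex_convexHull ℝ _)⟩
    rw [Finset.coe_insert, Set.insert_subset_iff]
    refine ⟨(convex_convexHull ℝ _).midpoint_mem (subset_convexHull ℝ _ ?_)
      (subset_convexHull ℝ _ ?_), fun a ha => subset_convexHull ℝ _ ?_⟩
    · simp
    · simp
    · simp only [Finset.coe_union, Set.mem_union]
      exact Or.inl ha

/-- Trade the weight `w u` at `u` and the same amount at `v` for `2 * w u` at the midpoint; the
vertex `u` is then no longer needed. -/
theorem IsEdgeSubdivision.mem_space_of_le (h : IsEdgeSubdivision X u v Y) {s : Finset E}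
    (hs : s ∈ X.faces) (hu : u ∈ s) (hv : v ∈ s) {w : E →₀ ℝ} {x : E}
    (hw : IsConvexCombination w x) (hws : w.support ⊆ s) (hle : w u ≤ w v) : x ∈ Y.space := by
  classical
  have hbs := midpoint_notMem_of_mem_faces X h.1 hs ⟨s, hs, hu, hv⟩
  have hun : s.erase u ∪ {u, v} = s := by
    ext a
    simp only [Finset.mem_union, Finset.mem_erase, Finset.mem_insert, Finset.mem_singleton]
    grind
  refine SimplicialComplex.mem_space_iff.2 ⟨insert (midpoint ℝ u v) (s.erase u), ?_, ?_⟩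
  · refine h.mem_faces_iff.2 (Or.inr ⟨s.erase u, ?_, ?_, by congr⟩)
    · convert hs
    · intro h'
      simpa using h' (Finset.mem_insert_self _ _)
  · obtain ⟨h0, h1, hx⟩ := hw
    refine mem_convexHull_iff_exists_isConvexCombination.2
      ⟨w + Finsupp.single (midpoint ℝ u v) (2 * w u) - Finsupp.single u (w u)
        - Finsupp.single v (w u), ⟨fun a => ?_, ?_, ?_⟩, fun a ha => ?_⟩
    · have hu0 := h0 u
      have ha0 := h0 a
      have hne := h.1
      have := midpoint_ne_left_of_ne h.1
      have := midpoint_ne_right_of_ne h.1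
      simp only [Finsupp.sub_apply, Finsupp.add_apply, Finsupp.single_apply]
      split_ifs <;> grind
    · simp only [map_add, map_sub, h1, Finsupp.linearCombination_single, smul_eq_mul]
      ring
    · simp only [map_add, map_sub, hx, Finsupp.linearCombination_single, id]
      rw [midpoint_eq_smul_add, invOf_eq_inv]
      generalize w _ = r
      module
    · rw [Finsupp.mem_support_iff] at ha
      by_contra hn
      simp only [Finset.mem_insert, Finset.mem_erase, not_or, not_and] at hn
      refine ha ?_
      have hne := h.1
      have has : a ≠ u → w a = 0 := fun hau =>
        Finsupp.notMem_support_iff.1 fun h' => hn.2 hau (hws h')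
      have hav : a ≠ v := fun hav => hn.2 (hav ▸ h.1.symm) (hav ▸ hv)
      simp only [Finsupp.sub_apply, Finsupp.add_apply, Finsupp.single_apply, Ne.symm hn.1,
        if_false, hav.symm]
      by_cases hau : a = u
      · simp [hau]
      · simp [Ne.symm hau, has hau]

theorem IsEdgeSubdivision.space_eq (h : IsEdgeSubdivision X u v Y) : Y.space = X.space := by
  classical
  refine Set.Subset.antisymm (fun x hx => ?_) fun x hx => ?_
  · obtain ⟨s, hs, hxs⟩ := SimplicialComplex.mem_space_iff.1 hx
    obtain ⟨t, ht, hst⟩ := h.exists_convexHull_subset hs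
    exact SimplicialComplex.mem_space_iff.2 ⟨t, ht, hst hxs⟩
  · obtain ⟨s, hs, hxs⟩ := SimplicialComplex.mem_space_iff.1 hx
    by_cases huv : u ∈ s ∧ v ∈ s
    · obtain ⟨w, hw, hws⟩ := mem_convexHull_iff_exists_isConvexCombination.1 hxs
      rcases le_total (w u) (w v) with hle | hle
      · exact h.mem_space_of_le hs huv.1 huv.2 hw hws hle
      · exact h.symm.mem_space_of_le hs huv.2 huv.1 hw hws hle
    · refine SimplicialComplex.mem_space_iff.2 ⟨s, h.mem_faces_iff.2 (Or.inl ⟨hs, ?_⟩), hxs⟩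
      simpa [Finset.insert_subset_iff] using huv

theorem IsEdgeSubdivision.refines (h : IsEdgeSubdivision X u v Y) : Refines Y X :=
  ⟨h.space_eq, fun _ => h.exists_convexHull_subset⟩

theorem Refines.trans {X Y Z : SimplicialComplex ℝ E} (h₁ : Refines Z Y) (h₂ : Refines Y X) :
    Refines Z X := by
  refine ⟨h₁.1.trans h₂.1, fun s hs => ?_⟩
  obtain ⟨t, ht, hst⟩ := h₁.2 s hs
  obtain ⟨r, hr, htr⟩ := h₂.2 t ht
  exact ⟨r, hr, hst.trans htr⟩

theorem IsIteratedEdgeSubdivision.refines (h : IsIteratedEdgeSubdivision X Y) : Refines Y X := by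
  induction h with
  | refl => exact ⟨rfl, fun s hs => ⟨s, hs, subset_rfl⟩⟩
  | tail _ h ih =>
    obtain ⟨u, v, h⟩ := h
    exact h.refines.trans ih

theorem IsIteratedEdgeSubdivision.finite (h : IsIteratedEdgeSubdivision X Y)
    (hX : X.faces.Finite) : Y.faces.Finite := by
  induction h with
  | refl => exact hX
  | tail _ h ih =>
    obtain ⟨u, v, h⟩ := h
    exact h.finite ih

end IsEdgeSubdivision

/-! ### Removing colour conflicts by subdivision -/

section ListColouring

variable {E : Type*} [AddCommGroup E] [Module ℝ E] {n : ℕ}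

/-- The facets of `X` on which the colouring `f` is not injective. -/
def conflictFacets (X : SimplicialComplex ℝ E) (f : E → Fin n) : Set (Finset E) :=
  {s | s ∈ X.facets ∧ ¬ Set.InjOn f (s : Set E)}

open Classical in
theorem IsEdgeSubdivision.facets_cases {X Y : SimplicialComplex ℝ E} {u v : E}
    (h : IsEdgeSubdivision X u v Y) {s : Finset E} (hs : s ∈ Y.facets) :
    (s ∈ X.facets ∧ ¬ {u, v} ⊆ s) ∨
      ∃ r ∈ X.facets, u ∈ r ∧ v ∈ r ∧
        (s = insert (midpoint ℝ u v) (r.erase u) ∨ s = insert (midpoint ℝ u v) (r.erase v)) := by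
  have hne := h.1
  have hmem : ∀ r ∈ X.faces, u ∈ r → v ∈ r → midpoint ℝ u v ∉ r := fun r hr hu hv =>
    midpoint_notMem_of_mem_faces X hne hr ⟨r, hr, hu, hv⟩
  have hnew : ∀ r ∈ X.faces, u ∈ r → v ∈ r → ∀ a ∈ ({u, v} : Finset E),
      insert (midpoint ℝ u v) (r.erase a) ∈ Y.faces := by
    intro r hr hu hv a ha
    refine h.mem_faces_iff.2 (Or.inr ⟨r.erase a, ?_, fun h' => by simpa using h' ha, rfl⟩)
    convert hr
    grind
  rcases h.mem_faces_iff.1 hs.1 with ⟨hsX, huv⟩ | ⟨t, ht, huv, rfl⟩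
  · refine Or.inl ⟨⟨hsX, fun r hr hsr => ?_⟩, huv⟩
    by_cases hr' : {u, v} ⊆ r
    -- Coning `s` from the midpoint would give a strictly larger face of `Y`.
    · exfalso
      have hu : u ∈ r := hr' (by simp)
      have hv : v ∈ r := hr' (by simp)
      have hb := hmem r hr hu hv
      have hY : insert (midpoint ℝ u v) s ∈ Y.faces :=
        h.mem_faces_iff.2 (Or.inr ⟨s, X.down_closed hr (Finset.union_subset hsr hr')
          ⟨u, by simp⟩, huv, rfl⟩)
      have := hs.2 hY (Finset.subset_insert _ _)
      exact hb (hsr (this ▸ Finset.mem_insert_self _ _))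
    · exact hs.2 (h.mem_faces_iff.2 (Or.inl ⟨hr, hr'⟩)) hsr
  · right
    have hb := hmem _ ht (by simp) (by simp)
    have hbt : midpoint ℝ u v ∉ t := fun h' => hb (Finset.mem_union_left _ h')
    -- Maximality in `Y` forces `t` to fill up any face of `X` above `t ∪ {u, v}`, except for the
    -- missing endpoint.
    have key : ∀ r ∈ X.faces, t ∪ {u, v} ⊆ r → ∀ a ∈ ({u, v} : Finset E), a ∉ t →
        t = r.erase a := by
      intro r hr hsub a ha hat
      have hu : u ∈ r := hsub (by simp)
      have hv : v ∈ r := hsub (by simp)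
      have hbr := hmem r hr hu hv
      have := hs.2 (hnew r hr hu hv a ha)
        (Finset.insert_subset_insert _ fun x hx => Finset.mem_erase.2
          ⟨ne_of_mem_of_not_mem hx hat, hsub (Finset.mem_union_left _ hx)⟩)
      rw [← Finset.erase_insert hbt, this,
        Finset.erase_insert fun h' => hbr (Finset.mem_of_mem_erase h')]
    obtain ⟨a, ha, hat⟩ := Finset.not_subset.1 huv
    refine ⟨t ∪ {u, v}, ⟨ht, fun r hr hsub => ?_⟩, by simp, by simp, ?_⟩
    · have h1 := key r hr hsub a ha hat
      have har : a ∈ r := hsub (Finset.mem_union_right _ ha)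
      refine hsub.antisymm ?_
      rw [← Finset.insert_erase har, ← h1]
      exact Finset.insert_subset (Finset.mem_union_right _ ha) Finset.subset_union_left
    · have h1 := key _ ht subset_rfl a ha hat
      rcases Finset.mem_insert.1 ha with rfl | ha
      · exact Or.inl (congrArg _ h1)
      · rw [Finset.mem_singleton] at ha
        subst ha
        exact Or.inr (congrArg _ h1)

/-- Restricting to facets matters: a new facet keeps `u` or `v`, hence their common colour, whereas
a smaller new face may lose both and its colour set need not contain an old one. -/
theorem exists_edgeSubdivision_of_conflict {X : SimplicialComplex ℝ E}
    {f : E → Fin n} {J : E → Set (Fin n)} (hf : ∀ x ∈ X.vertices, f x ∈ J x) {s : Finset E}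
    (hs : s ∈ conflictFacets X f)
    (hJ : ∀ x ∈ X.space, ∃ c ∈ J x, c ∉ s.image f) :
    ∃ (Y : SimplicialComplex ℝ E) (g : E → Fin n), (∃ u v, IsEdgeSubdivision X u v Y) ∧
      (∀ x ∈ Y.vertices, g x ∈ J x) ∧ ∃ c ∉ s.image f, ∀ r ∈ conflictFacets Y g,
        (r ∈ conflictFacets X f ∧ r ≠ s ∧ r.image g = r.image f) ∨
        ∃ r' ∈ conflictFacets X f, r.image g = insert c (r'.image f) := by
  classical
  obtain ⟨hsX, hinj⟩ := hs
  simp only [Set.InjOn, not_forall] at hinj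
  obtain ⟨u, hu, v, hv, hfuv, huv⟩ := hinj
  rw [Finset.mem_coe] at hu hv
  have hnot : ∀ r ∈ X.faces, midpoint ℝ u v ∉ r := fun r hr =>
    midpoint_notMem_of_mem_faces X huv hr ⟨s, hsX.1, hu, hv⟩
  have hsub := isEdgeSubdivision_edgeSubdivision X huv ⟨s, hsX.1, hu, hv⟩
  set Y := edgeSubdivision X huv ⟨s, hsX.1, hu, hv⟩
  have hbX : midpoint ℝ u v ∈ X.space := X.convexHull_subset_space hsX.1
    ((convex_convexHull ℝ _).midpoint_mem (subset_convexHull ℝ _ hu) (subset_convexHull ℝ _ hv))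
  obtain ⟨c, hcJ, hcs⟩ := hJ _ hbX
  have himage : ∀ r : Finset E, midpoint ℝ u v ∉ r →
      r.image (Function.update f (midpoint ℝ u v) c) = r.image f := fun r hr =>
    Finset.image_congr fun x hx => Function.update_of_ne (ne_of_mem_of_not_mem (Finset.mem_coe.1 hx) hr) _ _
  refine ⟨Y, Function.update f (midpoint ℝ u v) c, ⟨u, v, hsub⟩, fun x hx => ?_, c, hcs, ?_⟩
  · by_cases hxb : x = midpoint ℝ u v
    · rw [hxb, Function.update_self]
      exact hcJ
    · rw [Function.update_of_ne hxb]
      rcases hsub.mem_faces_iff.1 hx with ⟨hx, -⟩ | ⟨t, -, -, ht⟩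
      · exact hf x hx
      · exact absurd (Finset.mem_singleton.1 (ht ▸ Finset.mem_insert_self _ t)) (Ne.symm hxb)
  · rintro r ⟨hrY, hrinj⟩
    rcases hsub.facets_cases hrY with ⟨hrX, hr⟩ | ⟨t, htX, hut, hvt, hr⟩
    · have hb := hnot r hrX.1
      refine Or.inl ⟨⟨hrX, fun h' => hrinj (h'.congr fun x hx => ?_)⟩, ?_, himage r hb⟩
      · exact (Function.update_of_ne (ne_of_mem_of_not_mem (Finset.mem_coe.1 hx) hb) _ _).symm
      · rintro rfl
        exact hr (by simp [Finset.insert_subset_iff, hu, hv])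
    · refine Or.inr ⟨t, ⟨htX, fun h' => huv (h' hut hvt hfuv)⟩, ?_⟩
      have hb := hnot t htX.1
      have hberase : ∀ a, midpoint ℝ u v ∉ t.erase a := fun a h' => hb (Finset.mem_of_mem_erase h')
      have herase : ∀ a ∈ t, ∀ a' ∈ t, a ≠ a' → f a = f a' → (t.erase a).image f = t.image f := by
        intro a ha a' ha' hne he
        refine (Finset.image_subset_image (Finset.erase_subset _ _)).antisymm ?_
        conv_lhs => rw [← Finset.insert_erase ha, Finset.image_insert]
        exact Finset.insert_subset
          (Finset.mem_image.2 ⟨a', Finset.mem_erase.2 ⟨hne.symm, ha'⟩, he.symm⟩) subset_rfl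
      rcases hr with rfl | rfl
      · rw [Finset.image_insert, Function.update_self, himage _ (hberase u),
          herase u hut v hvt huv hfuv]
      · rw [Finset.image_insert, Function.update_self, himage _ (hberase v),
          herase v hvt u hut (Ne.symm huv) hfuv.symm]

/-- A simplicial complex with vertex lists that are at least as long as its simplices are large has
an iterated edge subdivision with a colouring from these lists which is injective on each facet.
The colour sets of the facets with conflicts range over an upper set `𝒰`, whose minimal elements are
eliminated one by one. -/
theorem exists_iteratedEdgeSubdivision_conflictFacets_eq_empty {k : ℕ} {P : Set E}
    {J : E → Set (Fin n)}
    (hcard : ∀ s : Finset E, AffineIndependent ℝ ((↑) : s → E) → (s : Set E) ⊆ P → s.card ≤ k)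
    (hJ : ∀ x ∈ P, ∀ S : Finset (Fin n), S.card < k → ∃ c ∈ J x, c ∉ S)
    (𝒰 : Finset (Finset (Fin n))) (h𝒰 : IsUpperSet (𝒰 : Set (Finset (Fin n))))
    (X : SimplicialComplex ℝ E) (hX : X.faces.Finite) (hP : X.space = P) (f : E → Fin n)
    (hf : ∀ x ∈ X.vertices, f x ∈ J x) (hconf : ∀ s ∈ conflictFacets X f, s.image f ∈ 𝒰) :
    ∃ (Y : SimplicialComplex ℝ E) (g : E → Fin n), IsIteratedEdgeSubdivision X Y ∧
      (∀ x ∈ Y.vertices, g x ∈ J x) ∧ conflictFacets Y g = ∅ := by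
  induction 𝒰 using Finset.strongInduction generalizing X f with
  | H 𝒰 ih =>
  rcases 𝒰.eq_empty_or_nonempty with rfl | hne
  · exact ⟨X, f, .refl, hf, Set.eq_empty_of_forall_notMem fun s hs => by simpa using hconf s hs⟩
  obtain ⟨S, hS⟩ := 𝒰.exists_minimal hne
  have hfin : ∀ (Z : SimplicialComplex ℝ E) (g : E → Fin n), Z.faces.Finite →
      {s ∈ conflictFacets Z g | s.image g = S}.Finite := fun Z g hZ =>
    hZ.subset fun s hs => hs.1.1.1
  -- Inner induction: the number of conflicting facets whose colour set is exactly the minimal `S`.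
  induction hm : {s ∈ conflictFacets X f | s.image f = S}.ncard using Nat.strong_induction_on
    generalizing X f with
  | _ m ihm =>
  by_cases hex : ∃ s ∈ conflictFacets X f, s.image f = S
  · obtain ⟨s, hs, hsS⟩ := hex
    have hsk : S.card < k := by
      rw [← hsS]
      refine (lt_of_le_of_ne Finset.card_image_le fun h' => hs.2 ?_).trans_le
        (hcard s (X.indep hs.1.1) (hP ▸ X.subset_space hs.1.1))
      exact Finset.card_image_iff.1 h'
    obtain ⟨Y, g, hsub, hg, c, hc, hY⟩ := exists_edgeSubdivision_of_conflict hf hs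
      fun x hx => hsS ▸ hJ x (hP ▸ hx) S hsk
    have hXY : IsIteratedEdgeSubdivision X Y := .single hsub
    obtain ⟨Z, g', hYZ, hZ⟩ := ihm _ (by
      rw [← hm]
      refine Set.ncard_lt_ncard ⟨fun r hr => ?_, fun h' => ?_⟩ (hfin X f hX)
      · rcases hY r hr.1 with ⟨h1, -, h3⟩ | ⟨r', -, h2⟩
        · exact ⟨h1, h3 ▸ hr.2⟩
        · exact absurd (Finset.mem_insert_self c _) (h2 ▸ hr.2 ▸ hsS ▸ hc)
      · have hsY := h' ⟨hs, hsS⟩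
        rcases hY s hsY.1 with ⟨-, h2, -⟩ | ⟨r', -, h2⟩
        · exact h2 rfl
        · exact hc (by rw [hsS, ← hsY.2, h2]; exact Finset.mem_insert_self c _))
      Y (hXY.finite hX) (hXY.refines.1.trans hP) g hg (fun r hr => by
        rcases hY r hr with ⟨h1, -, h3⟩ | ⟨r', h1, h2⟩
        · exact h3 ▸ hconf r h1
        · exact h2 ▸ h𝒰 (Finset.subset_insert _ _) (hconf r' h1)) rfl
    exact ⟨Z, g', hXY.trans hYZ, hZ⟩
  -- No conflict has colour set `S` any more, and minimality of `S` keeps the remaining family an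
  -- upper set.
  · refine ih (𝒰.erase S) (Finset.erase_ssubset hS.1) (fun A B hAB hA => ?_) X hX hP f hf
      fun s hs => Finset.mem_erase.2 ⟨fun h' => hex ⟨s, hs, h'⟩, hconf s hs⟩
    rw [Finset.mem_coe, Finset.mem_erase] at hA ⊢
    exact ⟨fun h' => hA.1 (hS.eq_of_le hA.2 (h' ▸ hAB)), h𝒰 hAB hA.2⟩

end ListColouring

/-! ### Lists from the Komiya cover, and the conclusion -/

theorem Geometry.SimplicialComplex.exists_facet_superset {E : Type*} [AddCommGroup E] [Module ℝ E]
    (X : SimplicialComplex ℝ E) (hX : X.faces.Finite) {s : Finset E} (hs : s ∈ X.faces) :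
    ∃ t ∈ X.facets, s ⊆ t := by
  obtain ⟨t, hst, ht⟩ := hX.exists_le_maximal hs
  exact ⟨t, ⟨ht.1, fun r hr htr => ht.eq_of_le hr htr⟩, hst⟩

theorem AffineIndependent.card_le_of_coe_subset {E : Type*} [AddCommGroup E] [Module ℝ E]
    [FiniteDimensional ℝ E] {P : Set E} {s : Finset E} (hs : AffineIndependent ℝ ((↑) : s → E))
    (hsP : (s : Set E) ⊆ P) : s.card ≤ Module.finrank ℝ (vectorSpan ℝ P) + 1 := by
  have h := hs.card_le_finrank_succ
  rw [Fintype.card_coe] at h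
  refine h.trans (Nat.succ_le_succ (Submodule.finrank_mono (vectorSpan_mono ℝ ?_)))
  simpa using hsP

theorem isFace_facialSupport {E : Type*} [AddCommGroup E] [Module ℝ E] {P : Set E}
    (hP : Convex ℝ P) {v : E} (hv : v ∈ P) : IsFace P (facialSupport P v) :=
  ⟨isExtreme_sInter ⟨P, ⟨IsExtreme.rfl, hP⟩, hv⟩ fun _ hF => hF.1.1,
    convex_sInter fun _ hF => hF.1.2⟩

/-- The complement of `S` has at least `n - k + 1` colours, so the cover condition for such an `I`
can be applied to the face `supp(v)`. -/
theorem IsWeaklyKomiyaCover.exists_notMem {E : Type*} [AddCommGroup E] [Module ℝ E]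
    [TopologicalSpace E] {n k : ℕ} (hkn : k ≤ n) {P : Set E} (hP : Convex ℝ P)
    {A : Fin n → ProperFaces P → Set E} (hA : IsWeaklyKomiyaCover k P A) {v : E} (hv : v ∈ P)
    (S : Finset (Fin n)) (hS : S.card < k) :
    ∃ i : Fin n, (∃ τ : ProperFaces P, v ∈ A i τ ∧ (τ : Set E) ⊆ facialSupport P v) ∧ i ∉ S := by
  have hcompl : n + 1 - k ≤ Sᶜ.card := by
    rw [Finset.card_compl, Fintype.card_fin]
    omega
  obtain ⟨I, hIS, hI⟩ := Finset.exists_subset_card_eq hcompl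
  have hmem := (hA.weaklyCovers I (by omega)).covers _ (isFace_facialSupport hP hv)
    (Set.mem_sInter.2 fun F hF => hF.2)
  simp only [Set.mem_iUnion] at hmem
  obtain ⟨τ, i, hi, hvi⟩ := hmem
  exact ⟨i, ⟨τ.1, hvi, τ.2⟩, Finset.mem_compl.1 (hIS hi)⟩

theorem theorem3p1 {d n k : ℕ} (hk : 2 ≤ k) (hkn : k ≤ n)
    (P : Set (EuclideanSpace ℝ (Fin d))) (hP : IsPolytope P)
    (hdim : Module.finrank ℝ (vectorSpan ℝ P) + 1 = k)
    (pt : Fin n → ProperFaces P → EuclideanSpace ℝ (Fin d))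
    (hpt : ∀ (i : Fin n) (τ : ProperFaces P), pt i τ ∈ (τ : Set (EuclideanSpace ℝ (Fin d))))
    (A : Fin n → ProperFaces P → Set (EuclideanSpace ℝ (Fin d)))
    (hA : IsWeaklyKomiyaCover k P A)
    (T : SimplicialComplex ℝ (EuclideanSpace ℝ (Fin d))) (hT : IsTriangulation T P) :
    ∃ T' : SimplicialComplex ℝ (EuclideanSpace ℝ (Fin d)),
      IsTriangulation T' P ∧ Refines T' T ∧ IsIteratedEdgeSubdivision T T' ∧
      ∃ (lam : T'.vertices → ProperFaces P) (f : T'.vertices → Fin n) (y : T'.vertices → P),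
        (∀ v : T'.vertices,
          (v : EuclideanSpace ℝ (Fin d)) ∈ A (f v) (lam v)) ∧
        (∀ v : T'.vertices,
          (y v : EuclideanSpace ℝ (Fin d)) ∈ (lam v : Set (EuclideanSpace ℝ (Fin d))) ∧
          (lam v : Set (EuclideanSpace ℝ (Fin d))) ⊆ facialSupport P v ∧
          (y v : EuclideanSpace ℝ (Fin d)) = pt (f v) (lam v)) ∧
        (∀ s ∈ T'.faces, ∀ u v : T'.vertices,
          (u : EuclideanSpace ℝ (Fin d)) ∈ s → (v : EuclideanSpace ℝ (Fin d)) ∈ s →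
          f u = f v → u = v) := by
  classical
  have hconv : Convex ℝ P := by
    obtain ⟨V, rfl⟩ := hP
    exact convex_convexHull ℝ _
  let J : EuclideanSpace ℝ (Fin d) → Set (Fin n) := fun v =>
    {i | ∃ τ : ProperFaces P, v ∈ A i τ ∧
      (τ : Set (EuclideanSpace ℝ (Fin d))) ⊆ facialSupport P v}
  have hJ : ∀ x ∈ P, ∀ S : Finset (Fin n), S.card < k → ∃ c ∈ J x, c ∉ S :=
    fun x hx S hS => hA.exists_notMem hkn hconv hx S hS
  -- The initial colouring is defined on the whole space; its value off `P` is arbitrary.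
  have hcolour : ∀ x, ∃ c : Fin n, x ∈ P → c ∈ J x := fun x => by
    by_cases hx : x ∈ P
    · obtain ⟨c, hc, -⟩ := hJ x hx ∅ (by simp; omega)
      exact ⟨c, fun _ => hc⟩
    · exact ⟨⟨0, by omega⟩, fun h => absurd h hx⟩
  choose f₀ hf₀ using hcolour
  obtain ⟨T', f, hsub, hf, hconf⟩ := exists_iteratedEdgeSubdivision_conflictFacets_eq_empty
    (fun s hs hsP => (hs.card_le_of_coe_subset hsP).trans_eq hdim) hJ Finset.univ
    (fun _ _ _ _ => by simp) T hT.1 hT.2 f₀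
    (fun x hx => hf₀ x (hT.2 ▸ T.vertices_subset_space hx)) (fun _ _ => Finset.mem_univ _)
  have hfin := hsub.finite hT.1
  have hspace : T'.space = P := hsub.refines.1.trans hT.2
  choose lam hlam hlamsupp using fun v : T'.vertices => hf v v.2
  refine ⟨T', ⟨hfin, hspace⟩, hsub.refines, hsub, lam, fun v => f v,
    fun v => ⟨pt (f v) (lam v), (lam v).2.1.1.subset (hpt _ _)⟩, hlam,
    fun v => ⟨hpt _ _, hlamsupp v, rfl⟩, fun s hs u v hu hv huv => Subtype.ext ?_⟩
  obtain ⟨t, ht, hst⟩ := T'.exists_facet_superset hfin hs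
  by_contra hne
  have : t ∈ conflictFacets T' f := ⟨ht, fun hinj => hne (hinj (hst hu) (hst hv) huv)⟩
  rw [hconf] at this
  exact this
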